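/- Let $n\ge 1$ and let $\Omega\subset\mathbb R^n$ be a bounded domain (a nonempty bounded connected open set). For $\delta>0$ put $\Omega^\delta=\Omega\cap(\delta\mathbb Z)^n$, let $K^\delta$ be the number of points of $\Omega^\delta$, and let $\partial\Omega^\delta$ be the set of points of $(\delta\mathbb Z)^n\setminus\Omega^\delta$ that have at least one of their $2n$ lattice neighbours in $\Omega^\delta$. On $(\delta\mathbb Z)^m$ let $\Delta_{\delta,m}u(x)=\delta^{-2}\bigl(\sum_{j=1}^m(u(x+\delta e_j)+u(x-\delta e_j))-2m\,u(x)\bigr)$. Let $\lambda_1^\delta\le\dots\le\lambda_{K^\delta}^\delta$ be the eigenvalues, counted with multiplicity, of the Dirichlet problem $-\Delta_{\delta,n}f=\lambda f$ in $\Omega^\delta$, $f=0$ on $\partial\Omega^\delta$, and put $a_k^\delta=\delta^{-1}\cosh^{-1}\bigl(1+\tfrac12\delta^2\lambda_k^\delta\bigr)$. For $\delta>0$, real $N\ge 0$ that is an integer multiple of $\delta$, and $A\in\mathbb R$, call (P) the following condition on a real function $u$ on $(\Omega^\delta\cup\partial\Omega^\delta)\times([-N,N]\cap\delta\mathbb Z)$: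 $\Delta_{\delta,n+1}u\ge 0$ at every point $(x',x_{n+1})$ with $x'\in\Omega^\delta$ and $|x_{n+1}|<N$; $u(x',x_{n+1})=0$ for $x'\in\partial\Omega^\delta$; and, with $u^+=\max\{0,u\}$, $$\sum_{x'\in\Omega^\delta}u^+(x',0)^2=A^2K^\delta>0 .$$ 1. If $u$ satisfies (P), then $$\max_{\Omega^\delta\times([-N,N]\cap\delta\mathbb Z)}u\ \ge\ \frac A2\Bigl(\sum_{k=1}^{K^\delta}\exp(-a_k^\delta N)\Bigr)^{-1}.$$ 2. There is a constant $C_\Omega>0$ that depends only on $\Omega$ such that, for every $\delta>0$, every $N\in\mathbb N$ that is an integer multiple of $\delta$, every $A$ and every $u$ satisfying (P), $$\max_{\Omega^\delta\times([-N,N]\cap\delta\mathbb Z)}u\ \ge\ C_\Omega\,A\,\exp(a_1^\delta N).$$ -/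

import Mathlib

noncomputable section

/- The lattice `(δℤ)^m` is parametrized by `ℤ^m`: the integer vector `z` stands for the lattice
point `δ z`.  A function on a subset of the lattice is a function on `ℤ^m` of which only the
values on that subset are used. -/

/-- The `δ`-discrete Laplacian
`δ⁻² (∑_j (u (x + δ e_j) + u (x - δ e_j)) - 2 m u x)` on `(δℤ)^m`. -/
def discreteLaplacian {m : ℕ} (δ : ℝ) (u : (Fin m → ℤ) → ℝ) (z : Fin m → ℤ) : ℝ :=
  (δ ^ 2)⁻¹ * ((∑ j : Fin m, (u (z + Pi.single j 1) + u (z - Pi.single j 1))) - 2 * m * u z)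

/-- `u` is `δ`-discrete subharmonic in the set `D` of lattice points. -/
def IsDiscreteSubharmonic {m : ℕ} (δ : ℝ) (u : (Fin m → ℤ) → ℝ) (D : Set (Fin m → ℤ)) : Prop :=
  ∀ z ∈ D, 0 ≤ discreteLaplacian δ u z

/-- The discrete boundary of `D`: lattice points outside `D` with at least one neighbour in `D`. -/
def latticeBoundary {m : ℕ} (D : Set (Fin m → ℤ)) : Set (Fin m → ℤ) :=
  {z | z ∉ D ∧ ∃ j : Fin m, z + Pi.single j 1 ∈ D ∨ z - Pi.single j 1 ∈ D}

/-- The discretization `Ω ∩ (δℤ)^n` of a set `Ω ⊆ ℝⁿ`. -/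
def latticePoints {n : ℕ} (Ω : Set (EuclideanSpace ℝ (Fin n))) (δ : ℝ) : Set (Fin n → ℤ) :=
  {z | WithLp.toLp 2 (fun i => δ * (z i : ℝ)) ∈ Ω}

theorem latticePoints_finite {n : ℕ} {Ω : Set (EuclideanSpace ℝ (Fin n))} {δ : ℝ}
    (hΩ : Bornology.IsBounded Ω) (hδ : 0 < δ) : (latticePoints Ω δ).Finite := by
  obtain ⟨R, hR⟩ := hΩ.exists_norm_le
  refine (Set.Finite.pi' (fun _ : Fin n => Set.finite_Icc (-⌈R / δ⌉) ⌈R / δ⌉)).subset ?_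
  intro z hz i
  have h1 := (PiLp.norm_apply_le (WithLp.toLp 2 (fun i => δ * (z i : ℝ)) :
    EuclideanSpace ℝ (Fin n)) i).trans (hR _ hz)
  have h2 : |(z i : ℝ)| ≤ R / δ := by
    rw [le_div_iff₀ hδ]
    simpa [abs_mul, abs_of_pos hδ, mul_comm] using h1
  have h3 := (abs_le.1 h2)
  have h4 := Int.le_ceil (R / δ)
  constructor
  · have : ((-⌈R / δ⌉ : ℤ) : ℝ) ≤ z i := by push_cast; linarith
    exact_mod_cast this
  · have : (z i : ℝ) ≤ ((⌈R / δ⌉ : ℤ) : ℝ) := by linarith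
    exact_mod_cast this

/-- `Ω ∩ (δℤ)^n` as a finite set, for bounded `Ω` and `δ > 0`. -/
def latticeFinset {n : ℕ} {Ω : Set (EuclideanSpace ℝ (Fin n))} {δ : ℝ}
    (hΩ : Bornology.IsBounded Ω) (hδ : 0 < δ) : Finset (Fin n → ℤ) :=
  (latticePoints_finite hΩ hδ).toFinset

/-- Extension by zero of a function on a finite set of lattice points. -/
def extendByZero {m : ℕ} (S : Finset (Fin m → ℤ)) (g : S → ℝ) (z : Fin m → ℤ) : ℝ :=
  if h : z ∈ S then g ⟨z, h⟩ else 0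

/-- The operator `-Δ_δ` on `S` with zero Dirichlet condition: extend by zero, apply `-Δ_δ`,
restrict to `S`. -/
def dirichletLaplacian {m : ℕ} (δ : ℝ) (S : Finset (Fin m → ℤ)) : (S → ℝ) →ₗ[ℝ] (S → ℝ) where
  toFun g x := -discreteLaplacian δ (extendByZero S g) x
  map_add' g h := by
    have key : ∀ z, extendByZero S (g + h) z = extendByZero S g z + extendByZero S h z := by
      intro z
      unfold extendByZero
      split_ifs <;> simp
    funext x
    simp only [discreteLaplacian, key, Pi.add_apply, Finset.sum_add_distrib]
    ring
  map_smul' c g := by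
    have key : ∀ z, extendByZero S (c • g) z = c * extendByZero S g z := by
      intro z
      unfold extendByZero
      split_ifs <;> simp
    funext x
    simp only [discreteLaplacian, key, Pi.smul_apply, smul_eq_mul, RingHom.id_apply,
      Finset.sum_add_distrib, ← Finset.mul_sum]
    ring

/-- The matrix of the Dirichlet operator `-Δ_δ` on `S` in the standard basis. -/
def dirichletMatrix {m : ℕ} (δ : ℝ) (S : Finset (Fin m → ℤ)) : Matrix S S ℝ :=
  LinearMap.toMatrix' (dirichletLaplacian δ S)

theorem dirichletMatrix_isHermitian {m : ℕ} (δ : ℝ) (S : Finset (Fin m → ℤ)) :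
    (dirichletMatrix δ S).IsHermitian := by
  have key : ∀ (y : S) (z : Fin m → ℤ),
      extendByZero S (Pi.single y 1) z = if z = y.1 then 1 else 0 := by
    intro y z
    unfold extendByZero
    by_cases h : z ∈ S
    · simp [h, Pi.single_apply, Subtype.ext_iff]
    · have : z ≠ y.1 := fun e => h (e ▸ y.2)
      simp [h, this]
  ext x y
  simp only [Matrix.conjTranspose_apply, star_trivial, dirichletMatrix, LinearMap.toMatrix'_apply,
    dirichletLaplacian, LinearMap.coe_mk, AddHom.coe_mk, discreteLaplacian]
  have e1 : ∀ a b c : Fin m → ℤ, (a + c = b) = (b - c = a) := fun a b c => by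
    rw [eq_iff_iff]
    constructor <;> rintro rfl <;> simp
  have e5 : ∀ y : S, extendByZero S (Pi.single y 1)
      = fun z => if z = y.1 then 1 else 0 := fun y => funext (key y)
  have e3 : ((y : Fin m → ℤ) = (x : Fin m → ℤ)) = ((x : Fin m → ℤ) = (y : Fin m → ℤ)) :=
    propext eq_comm
  simp only [e5, e1, add_comm]
  simp only [e3]

/-- The `k`-th Dirichlet eigenvalue `λ_k` of `-Δ_δ` on `S`, for `1 ≤ k ≤ #S`, counted with
multiplicity in nondecreasing order `λ_1 ≤ λ_2 ≤ …`  (and `0` for other `k`).  The eigenvalues in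
Mathlib are in nonincreasing order, whence the reversal. -/
def dirichletEigenvalue {m : ℕ} (δ : ℝ) (S : Finset (Fin m → ℤ)) (k : ℕ) : ℝ :=
  if h : 1 ≤ k ∧ k ≤ Fintype.card S then
    (dirichletMatrix_isHermitian δ S).eigenvalues₀ (Fin.rev ⟨k - 1, by omega⟩)
  else 0

/-- `a_k = δ⁻¹ cosh⁻¹(1 + δ² λ_k / 2)`. -/
def cylinderExponent {m : ℕ} (δ : ℝ) (S : Finset (Fin m → ℤ)) (k : ℕ) : ℝ :=
  δ⁻¹ * Real.arcosh (1 + δ ^ 2 * dirichletEigenvalue δ S k / 2)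

/-- `Ω^δ × [-N, N]`: lattice points `(x', x_{n+1})` of `(δℤ)^{n+1}` with `x' ∈ Ω` and
`|x_{n+1}| ≤ N`. -/
def truncatedCylinder {n : ℕ} (Ω : Set (EuclideanSpace ℝ (Fin n))) (δ N : ℝ) :
    Set (Fin (n + 1) → ℤ) :=
  {p | Fin.init p ∈ latticePoints Ω δ ∧ |δ * (p (Fin.last n) : ℝ)| ≤ N}

/-- `Ω^δ × (-N, N)`. -/
def openTruncatedCylinder {n : ℕ} (Ω : Set (EuclideanSpace ℝ (Fin n))) (δ N : ℝ) :
    Set (Fin (n + 1) → ℤ) :=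
  {p | Fin.init p ∈ latticePoints Ω δ ∧ |δ * (p (Fin.last n) : ℝ)| < N}

/-- `∂Ω^δ × [-N, N]`. -/
def lateralBoundary {n : ℕ} (Ω : Set (EuclideanSpace ℝ (Fin n))) (δ N : ℝ) :
    Set (Fin (n + 1) → ℤ) :=
  {p | Fin.init p ∈ latticeBoundary (latticePoints Ω δ) ∧ |δ * (p (Fin.last n) : ℝ)| ≤ N}

/-- `u` is `δ`-discrete subharmonic in `Ω^δ × (-N, N)`, vanishes on `∂Ω^δ × [-N, N]`, and
`∑_{x' ∈ Ω^δ} u⁺(x', 0)² = A² K > 0`, where `K` is the number of points of `Ω^δ`. -/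
structure IsPositiveCylinderSubsolution {n : ℕ} {Ω : Set (EuclideanSpace ℝ (Fin n))} {δ : ℝ}
    (hΩ : Bornology.IsBounded Ω) (hδ : 0 < δ) (N A : ℝ) (u : (Fin (n + 1) → ℤ) → ℝ) : Prop where
  subharmonic : IsDiscreteSubharmonic δ u (openTruncatedCylinder Ω δ N)
  eq_zero : ∀ p ∈ lateralBoundary Ω δ N, u p = 0
  sum_eq : ∑ x ∈ latticeFinset hΩ hδ, (max 0 (u (Fin.snoc x (0 : ℤ)))) ^ 2
    = A ^ 2 * ((latticeFinset hΩ hδ).card : ℝ)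
  pos : 0 < A ^ 2 * ((latticeFinset hΩ hδ).card : ℝ)

end

/-! Let `g t` be the `ℓ²` norm over the cross-section of the positive part of `u` at height `t`. The
positive part is again subharmonic with zero lateral values. Pairing this inequality with the slice
itself, the Rayleigh bound turns the cross-sectional Laplacian into the factor `λ₁`, and
Cauchy–Schwarz gives `2 cosh(δ a₁) g t ≤ g (t + 1) + g (t - 1)`, since `2 cosh(δ a₁) = 2 + δ² λ₁`
(`sqrt_sum_recurrence`).

Comparison with `cosh`, after symmetrizing in `t`, bounds the mean of `g` at the two ends below by
`cosh(a₁ N) g 0 = cosh(a₁ N) |A| √K`. Each end value is at most `M √K`, where `M` is the maximum of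
`u`, so `M ≥ |A| cosh(a₁ N) ≥ (A / 2) exp(a₁ N)`. This is the second claim with `C = 1 / 2` for
every `Ω`. The first is weaker: its sum is at least its `k = 1` term. -/

/-! ### Spectral bounds for the discrete Dirichlet Laplacian. -/

open Matrix in
/-- The Rayleigh lower bound for a real symmetric matrix. -/
theorem Matrix.IsHermitian.mul_dotProduct_le_dotProduct_mulVec {ι : Type*} [Fintype ι]
    [DecidableEq ι] {B : Matrix ι ι ℝ} (hB : B.IsHermitian) {μ : ℝ}
    (hμ : ∀ i, μ ≤ hB.eigenvalues i) (f : ι → ℝ) :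
    μ * (f ⬝ᵥ f) ≤ f ⬝ᵥ (B *ᵥ f) := by
  set b := hB.eigenvectorBasis
  set F : EuclideanSpace ℝ ι := WithLp.toLp 2 f
  have hin : ∀ g h : ι → ℝ, inner ℝ (WithLp.toLp 2 g : EuclideanSpace ℝ ι) (WithLp.toLp 2 h)
      = g ⬝ᵥ h := fun g h => by
    rw [EuclideanSpace.inner_toLp_toLp, star_trivial, dotProduct_comm]
  have h1 : ∀ i, inner ℝ (b i) (WithLp.toLp 2 (B *ᵥ f) : EuclideanSpace ℝ ι)
      = hB.eigenvalues i * inner ℝ (b i) F := fun i => by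
    have h2 := hB.mulVec_eigenvectorBasis i
    have h3 : Bᵀ = B := by simpa [Matrix.IsHermitian, conjTranspose] using hB
    calc _ = (b i).ofLp ⬝ᵥ (B *ᵥ f) := hin _ _
      _ = (B *ᵥ (b i).ofLp) ⬝ᵥ f := by rw [dotProduct_mulVec, ← mulVec_transpose, h3]
      _ = hB.eigenvalues i * ((b i).ofLp ⬝ᵥ f) := by rw [h2, smul_dotProduct, smul_eq_mul]
      _ = _ := by rw [← hin]
  -- Parseval in the eigenbasis reduces the claim to a comparison coefficient by coefficient.
  rw [← hin f f, ← hin f (B *ᵥ f), ← b.sum_inner_mul_inner, ← b.sum_inner_mul_inner,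
    Finset.mul_sum]
  refine Finset.sum_le_sum fun i _ => ?_
  rw [h1, real_inner_comm (b i) F]
  nlinarith [hμ i, mul_self_nonneg (inner ℝ (b i) F)]

theorem dirichletMatrix_mulVec {m : ℕ} (δ : ℝ) (S : Finset (Fin m → ℤ)) (f : S → ℝ) :
    (dirichletMatrix δ S).mulVec f = dirichletLaplacian δ S f := by
  rw [dirichletMatrix, LinearMap.toMatrix'_mulVec]

theorem extendByZero_coe {m : ℕ} (S : Finset (Fin m → ℤ)) (g : S → ℝ) (x : S) :
    extendByZero S g x = g x := by
  simp [extendByZero]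

theorem extendByZero_of_notMem {m : ℕ} {S : Finset (Fin m → ℤ)} (g : S → ℝ) {z : Fin m → ℤ}
    (hz : z ∉ S) : extendByZero S g z = 0 := by
  simp [extendByZero, hz]

/-- Translating `S` by `v` is injective, and only the translated points that land back in `S`
contribute, so the sum runs over a subset of `S`. -/
theorem sum_extendByZero_add_sq_le {m : ℕ} (S : Finset (Fin m → ℤ)) (g : S → ℝ)
    (v : Fin m → ℤ) :
    ∑ x : S, extendByZero S g (x + v) ^ 2 ≤ ∑ x : S, g x ^ 2 := by
  have h1 : ∑ x : S, g x ^ 2 = ∑ z ∈ S, extendByZero S g z ^ 2 := by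
    rw [← Finset.sum_coe_sort S]
    simp only [extendByZero_coe]
  have h2 : ∑ x : S, extendByZero S g (x + v) ^ 2
      = ∑ z ∈ S.map (addRightEmbedding v), extendByZero S g z ^ 2 := by
    rw [Finset.sum_map, ← Finset.sum_coe_sort S]
    rfl
  rw [h1, h2]
  have h3 : ∑ z ∈ S.map (addRightEmbedding v) with z ∈ S, extendByZero S g z ^ 2
      = ∑ z ∈ S.map (addRightEmbedding v), extendByZero S g z ^ 2 :=
    Finset.sum_filter_of_ne fun z _ hz => by
      by_contra hzS
      exact hz (by simp [extendByZero_of_notMem g hzS])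
  rw [← h3]
  exact Finset.sum_le_sum_of_subset_of_nonneg (fun z hz => (Finset.mem_filter.1 hz).2)
    fun z _ _ => sq_nonneg _

/-- In each direction the two neighbour correlations are at most `∑ g²` each, by `2ab ≤ a² + b²` and
the translation bound, so the diagonal term `2 ∑ g²` dominates them. -/
theorem dotProduct_dirichletLaplacian_nonneg {m : ℕ} (δ : ℝ) (S : Finset (Fin m → ℤ))
    (g : S → ℝ) : 0 ≤ g ⬝ᵥ dirichletLaplacian δ S g := by
  have h1 : ∀ x : S, g x * dirichletLaplacian δ S g x = (δ ^ 2)⁻¹ * ∑ j : Fin m,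
      (2 * g x ^ 2 - g x * extendByZero S g (x.1 + Pi.single j 1)
        - g x * extendByZero S g (x.1 + -Pi.single j 1)) := fun x => by
    simp only [dirichletLaplacian, LinearMap.coe_mk, AddHom.coe_mk, discreteLaplacian,
      extendByZero_coe, Finset.sum_sub_distrib, Finset.sum_add_distrib, ← Finset.mul_sum,
      Finset.sum_const, Finset.card_univ, Fintype.card_fin, nsmul_eq_mul, ← sub_eq_add_neg]
    ring
  have h2 : ∀ v : Fin m → ℤ, ∑ x : S, g x * extendByZero S g (x + v) ≤ ∑ x : S, g x ^ 2 :=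
    fun v => by
      have h3 : ∑ x : S, g x * extendByZero S g (x + v)
          ≤ ∑ x : S, (g x ^ 2 / 2 + extendByZero S g (x + v) ^ 2 / 2) :=
        Finset.sum_le_sum fun x _ => by
          nlinarith [sq_nonneg (g x - extendByZero S g (x + v))]
      rw [Finset.sum_add_distrib, ← Finset.sum_div, ← Finset.sum_div] at h3
      linarith [sum_extendByZero_add_sq_le S g v]
  simp only [dotProduct, h1]
  rw [← Finset.mul_sum, Finset.sum_comm]
  refine mul_nonneg (by positivity) (Finset.sum_nonneg fun j _ => ?_)
  rw [Finset.sum_sub_distrib, Finset.sum_sub_distrib, ← Finset.mul_sum]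
  linarith [h2 (Pi.single j 1), h2 (-Pi.single j 1)]

theorem dirichletMatrix_posSemidef {m : ℕ} (δ : ℝ) (S : Finset (Fin m → ℤ)) :
    (dirichletMatrix δ S).PosSemidef := by
  refine Matrix.PosSemidef.of_dotProduct_mulVec_nonneg (dirichletMatrix_isHermitian δ S)
    fun g => ?_
  rw [star_trivial, dirichletMatrix_mulVec]
  exact dotProduct_dirichletLaplacian_nonneg δ S g

theorem dirichletEigenvalue_one_le {m : ℕ} (δ : ℝ) {S : Finset (Fin m → ℤ)}
    (i : S) : dirichletEigenvalue δ S 1 ≤ (dirichletMatrix_isHermitian δ S).eigenvalues i := by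
  have hc : 1 ≤ Fintype.card S := Fintype.card_pos_iff.2 ⟨i⟩
  rw [dirichletEigenvalue, dif_pos ⟨le_rfl, hc⟩]
  -- The index `k = 1` reverses to the last position of the nonincreasing list.
  refine Matrix.IsHermitian.eigenvalues₀_antitone _ ?_
  rw [Fin.le_def, Fin.val_rev]
  simp only [Nat.sub_self]
  omega

theorem dirichletEigenvalue_nonneg {m : ℕ} (δ : ℝ) (S : Finset (Fin m → ℤ)) (k : ℕ) :
    0 ≤ dirichletEigenvalue δ S k := by
  unfold dirichletEigenvalue
  split_ifs with h
  · have h1 := (dirichletMatrix_posSemidef δ S).eigenvalues_nonneg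
      ((Fintype.equivOfCardEq (Fintype.card_fin _)) (Fin.rev ⟨k - 1, by omega⟩))
    simpa [Matrix.IsHermitian.eigenvalues] using h1
  · exact le_rfl

theorem dirichletEigenvalue_one_mul_le {m : ℕ} (δ : ℝ) (S : Finset (Fin m → ℤ)) (g : S → ℝ) :
    dirichletEigenvalue δ S 1 * ∑ x, g x ^ 2 ≤ ∑ x, g x * dirichletLaplacian δ S g x := by
  have h := (dirichletMatrix_isHermitian δ S).mul_dotProduct_le_dotProduct_mulVec
    (dirichletEigenvalue_one_le δ) g
  rw [dirichletMatrix_mulVec] at h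
  simpa [dotProduct, sq] using h

/-! ### One-dimensional comparison with the hyperbolic cosine. -/

open Real in
/-- One-dimensional comparison with the hyperbolic cosine on the half-line. -/
theorem cosh_mul_le_of_recurrence {θ : ℝ} {m : ℕ} {G : ℕ → ℝ} (h0 : 0 < m → cosh θ * G 0 ≤ G 1)
    (hG : ∀ t, t + 1 < m → 2 * cosh θ * G (t + 1) ≤ G (t + 2) + G t) :
    cosh (m * θ) * G 0 ≤ G m := by
  -- This says that `G t / cosh(tθ)` is nondecreasing, written without division. It propagates
  -- because `cosh(tθ)` solves the recurrence with equality; no sign of `G` is needed.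
  have key : ∀ t : ℕ, t < m → cosh ((t + 1 : ℕ) * θ) * G t ≤ cosh (t * θ) * G (t + 1) := by
    intro t
    induction t with
    | zero => simpa using h0
    | succ t ih =>
      intro ht
      have h1 := ih (by omega)
      have h2 := hG t ht
      have e1 : cosh ((t + 1 + 1 : ℕ) * θ) = 2 * cosh θ * cosh ((t + 1 : ℕ) * θ) - cosh (t * θ) := by
        have e2 : ((t + 1 + 1 : ℕ) : ℝ) * θ = (t + 1 : ℕ) * θ + θ := by push_cast; ring
        have e3 : (t : ℝ) * θ = (t + 1 : ℕ) * θ - θ := by push_cast; ring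
        rw [e2, e3, cosh_add, cosh_sub]
        ring
      have h3 := mul_le_mul_of_nonneg_left h2 (cosh_pos ((t + 1 : ℕ) * θ)).le
      rw [e1]
      nlinarith
  have main : ∀ t : ℕ, t ≤ m → cosh (t * θ) * G 0 ≤ G t := by
    intro t
    induction t with
    | zero => simp
    | succ t ih =>
      intro ht
      have h1 := mul_le_mul_of_nonneg_left (ih (by omega)) (cosh_pos ((t + 1 : ℕ) * θ)).le
      have h2 := key t (by omega)
      refine le_of_mul_le_mul_left ?_ (cosh_pos (t * θ))
      linarith
  exact main m le_rfl

open Real in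
/-- One-dimensional comparison with the hyperbolic cosine on a symmetric interval. -/
theorem two_mul_cosh_mul_le_of_recurrence {θ : ℝ} {m : ℕ} {g : ℤ → ℝ}
    (hg : ∀ t : ℤ, |t| < m → 2 * cosh θ * g t ≤ g (t + 1) + g (t - 1)) :
    2 * (cosh (m * θ) * g 0) ≤ g m + g (-m) := by
  -- The even part of `g` satisfies the same recurrence, and at `t = 0` evenness supplies the
  -- initial inequality, the discrete form of zero slope, that singles out `cosh`.
  have h := cosh_mul_le_of_recurrence (θ := θ) (m := m) (G := fun t => g t + g (-t)) ?_ ?_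
  · simp only [Nat.cast_zero, neg_zero] at h
    linarith
  · intro hm
    have := hg 0 (by simpa using hm)
    simp only [zero_add, zero_sub] at this
    simp only [Nat.cast_zero, neg_zero, Nat.cast_one]
    linarith
  · intro t ht
    have h1 := hg (t + 1 : ℕ) (by rw [abs_of_nonneg (by positivity)]; exact_mod_cast ht)
    have h2 := hg (-(t + 1 : ℕ)) (by rw [abs_neg, abs_of_nonneg (by positivity)]; exact_mod_cast ht)
    have e1 : ((t + 1 : ℕ) : ℤ) + 1 = (t + 2 : ℕ) := by push_cast; ring
    have e2 : ((t + 1 : ℕ) : ℤ) - 1 = (t : ℕ) := by push_cast; ring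
    have e3 : -((t + 1 : ℕ) : ℤ) + 1 = -(t : ℕ) := by push_cast; ring
    have e4 : -((t + 1 : ℕ) : ℤ) - 1 = -(t + 2 : ℕ) := by push_cast; ring
    rw [e1, e2] at h1
    rw [e3, e4] at h2
    linarith

/-! ### Separating the axial variable from the cross-section. -/

theorem snoc_add_single_castSucc {n : ℕ} (x : Fin n → ℤ) (t : ℤ) (j : Fin n) (c : ℤ) :
    (Fin.snoc x t : Fin (n + 1) → ℤ) + Pi.single j.castSucc c = Fin.snoc (x + Pi.single j c) t := by
  ext i
  refine Fin.lastCases ?_ (fun i => ?_) i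
  · simp
  · simp [Pi.single_apply]

theorem snoc_add_single_last {n : ℕ} (x : Fin n → ℤ) (t c : ℤ) :
    (Fin.snoc x t : Fin (n + 1) → ℤ) + Pi.single (Fin.last n) c = Fin.snoc x (t + c) := by
  ext i
  refine Fin.lastCases ?_ (fun i => ?_) i
  · simp
  · simp

/-- The central weight `2(n + 1)` splits into `2n` for the cross-section and `2` for the axis. -/
theorem discreteLaplacian_snoc {n : ℕ} (δ : ℝ) (u : (Fin (n + 1) → ℤ) → ℝ) (x : Fin n → ℤ)
    (t : ℤ) :
    discreteLaplacian δ u (Fin.snoc x t) = discreteLaplacian δ (fun y => u (Fin.snoc y t)) x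
      + (δ ^ 2)⁻¹ * (u (Fin.snoc x (t + 1)) + u (Fin.snoc x (t - 1)) - 2 * u (Fin.snoc x t)) := by
  simp only [discreteLaplacian, Fin.sum_univ_castSucc, sub_eq_add_neg _ (Pi.single _ _),
    ← Pi.single_neg, snoc_add_single_castSucc, snoc_add_single_last]
  push_cast
  simp only [← sub_eq_add_neg]
  ring

/-! ### Slices of the cylinder and growth of their norms. -/

section Cylinder

variable {n : ℕ} {Ω : Set (EuclideanSpace ℝ (Fin n))} {δ : ℝ}

theorem mem_latticeFinset {hΩ : Bornology.IsBounded Ω} {hδ : 0 < δ} {z : Fin n → ℤ} :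
    z ∈ latticeFinset hΩ hδ ↔ z ∈ latticePoints Ω δ := by
  simp [latticeFinset]

theorem abs_mul_intCast_le_iff (hδ : 0 < δ) (t : ℤ) (m : ℕ) :
    |δ * (t : ℝ)| ≤ m * δ ↔ |t| ≤ m := by
  rw [abs_mul, abs_of_pos hδ, mul_comm, mul_le_mul_iff_left₀ hδ]
  exact_mod_cast Iff.rfl

theorem abs_mul_intCast_lt_iff (hδ : 0 < δ) (t : ℤ) (m : ℕ) :
    |δ * (t : ℝ)| < m * δ ↔ |t| < m := by
  rw [abs_mul, abs_of_pos hδ, mul_comm, mul_lt_mul_iff_left₀ hδ]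
  exact_mod_cast Iff.rfl

theorem snoc_mem_truncatedCylinder (hδ : 0 < δ) {m : ℕ} {x : Fin n → ℤ} {t : ℤ} :
    (Fin.snoc x t : Fin (n + 1) → ℤ) ∈ truncatedCylinder Ω δ (m * δ) ↔
      x ∈ latticePoints Ω δ ∧ |t| ≤ m := by
  simp only [truncatedCylinder, Set.mem_ofPred_eq, Fin.init_snoc, Fin.snoc_last,
    abs_mul_intCast_le_iff hδ]

theorem snoc_mem_openTruncatedCylinder (hδ : 0 < δ) {m : ℕ} {x : Fin n → ℤ} {t : ℤ} :
    (Fin.snoc x t : Fin (n + 1) → ℤ) ∈ openTruncatedCylinder Ω δ (m * δ) ↔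
      x ∈ latticePoints Ω δ ∧ |t| < m := by
  simp only [openTruncatedCylinder, Set.mem_ofPred_eq, Fin.init_snoc, Fin.snoc_last,
    abs_mul_intCast_lt_iff hδ]

theorem snoc_mem_lateralBoundary (hδ : 0 < δ) {m : ℕ} {x : Fin n → ℤ} {t : ℤ} :
    (Fin.snoc x t : Fin (n + 1) → ℤ) ∈ lateralBoundary Ω δ (m * δ) ↔
      x ∈ latticeBoundary (latticePoints Ω δ) ∧ |t| ≤ m := by
  simp only [lateralBoundary, Set.mem_ofPred_eq, Fin.init_snoc, Fin.snoc_last,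
    abs_mul_intCast_le_iff hδ]

theorem truncatedCylinder_finite (hΩ : Bornology.IsBounded Ω) (hδ : 0 < δ) (m : ℕ) :
    (truncatedCylinder Ω δ (m * δ)).Finite := by
  refine (((latticePoints_finite hΩ hδ).prod (Set.finite_Icc (-(m : ℤ)) m)).image
    fun q => (Fin.snoc q.1 q.2 : Fin (n + 1) → ℤ)).subset fun p hp => ?_
  rw [← Fin.snoc_init_self (α := fun _ => ℤ) p, snoc_mem_truncatedCylinder hδ] at hp
  exact ⟨(Fin.init p, p (Fin.last n)), ⟨hp.1, abs_le.1 hp.2⟩, Fin.snoc_init_self _⟩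

/-- The positive part of `u` on the cross-section of the cylinder at height `t`. -/
def positiveSlice (hΩ : Bornology.IsBounded Ω) (hδ : 0 < δ) (u : (Fin (n + 1) → ℤ) → ℝ) (t : ℤ)
    (x : latticeFinset hΩ hδ) : ℝ :=
  max 0 (u (Fin.snoc x.1 t))

variable {hΩ : Bornology.IsBounded Ω} {hδ : 0 < δ} {u : (Fin (n + 1) → ℤ) → ℝ}

theorem positiveSlice_nonneg (t : ℤ) (x : latticeFinset hΩ hδ) :
    0 ≤ positiveSlice hΩ hδ u t x := le_max_left _ _

/-- The positive part of a subharmonic function with zero lateral values is subharmonic. -/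
theorem IsPositiveCylinderSubsolution.positiveSlice_subharmonic {m : ℕ} {A : ℝ}
    (h : IsPositiveCylinderSubsolution hΩ hδ (m * δ) A u) {t : ℤ} (ht : |t| < m)
    (x : latticeFinset hΩ hδ) :
    2 * positiveSlice hΩ hδ u t x
        + δ ^ 2 * dirichletLaplacian δ (latticeFinset hΩ hδ) (positiveSlice hΩ hδ u t) x
      ≤ positiveSlice hΩ hδ u (t + 1) x + positiveSlice hΩ hδ u (t - 1) x := by
  have hx : x.1 ∈ latticePoints Ω δ := mem_latticeFinset.1 x.2
  have hsub := h.subharmonic _ ((snoc_mem_openTruncatedCylinder hδ).2 ⟨hx, ht⟩)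
  rw [discreteLaplacian_snoc, discreteLaplacian, ← mul_add] at hsub
  have hsub' := (mul_nonneg_iff_of_pos_left (by positivity)).1 hsub
  -- A neighbour of `x` outside `Ω^δ` is a boundary point, where `u` vanishes; hence extending the
  -- positive part by zero agrees with `u⁺` at all neighbours.
  have hext : ∀ z : Fin n → ℤ, (∃ j, z + Pi.single j 1 = x.1 ∨ z - Pi.single j 1 = x.1) →
      extendByZero (latticeFinset hΩ hδ) (positiveSlice hΩ hδ u t) z
        = max 0 (u (Fin.snoc z t)) := by
    rintro z ⟨j, hj⟩
    by_cases hz : z ∈ latticeFinset hΩ hδ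
    · exact extendByZero_coe _ _ ⟨z, hz⟩
    · rw [extendByZero_of_notMem _ hz, h.eq_zero, max_self]
      refine (snoc_mem_lateralBoundary hδ).2 ⟨⟨fun hz' => hz (mem_latticeFinset.2 hz'), j, ?_⟩,
        ht.le⟩
      rcases hj with hj | hj
      · exact Or.inl (hj.symm ▸ hx)
      · exact Or.inr (hj.symm ▸ hx)
  have hL : δ ^ 2 * dirichletLaplacian δ (latticeFinset hΩ hδ) (positiveSlice hΩ hδ u t) x
      = 2 * n * positiveSlice hΩ hδ u t x - ∑ j : Fin n,
        (max 0 (u (Fin.snoc (x.1 + Pi.single j 1) t))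
          + max 0 (u (Fin.snoc (x.1 - Pi.single j 1) t))) := by
    have hδ' : δ ^ 2 ≠ 0 := by positivity
    simp only [dirichletLaplacian, LinearMap.coe_mk, AddHom.coe_mk, discreteLaplacian,
      extendByZero_coe]
    rw [mul_neg, mul_inv_cancel_left₀ hδ', neg_sub]
    congr 1
    exact Finset.sum_congr rfl fun j _ => by
      rw [hext _ ⟨j, Or.inr (by simp)⟩, hext _ ⟨j, Or.inl (by simp)⟩]
  rw [hL]
  have hsum : ∑ j : Fin n, (u (Fin.snoc (x.1 + Pi.single j 1) t)
        + u (Fin.snoc (x.1 - Pi.single j 1) t))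
      ≤ ∑ j : Fin n, (max 0 (u (Fin.snoc (x.1 + Pi.single j 1) t))
          + max 0 (u (Fin.snoc (x.1 - Pi.single j 1) t))) :=
    Finset.sum_le_sum fun j _ => add_le_add (le_max_right _ _) (le_max_right _ _)
  have hsum0 : 0 ≤ ∑ j : Fin n, (max 0 (u (Fin.snoc (x.1 + Pi.single j 1) t))
          + max 0 (u (Fin.snoc (x.1 - Pi.single j 1) t))) :=
    Finset.sum_nonneg fun j _ => add_nonneg (le_max_left _ _) (le_max_left _ _)
  have h1 : u (Fin.snoc x.1 (t + 1)) ≤ positiveSlice hΩ hδ u (t + 1) x := le_max_right _ _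
  have h2 : u (Fin.snoc x.1 (t - 1)) ≤ positiveSlice hΩ hδ u (t - 1) x := le_max_right _ _
  have h3 := positiveSlice_nonneg (u := u) (t + 1) x
  have h4 := positiveSlice_nonneg (u := u) (t - 1) x
  -- Where `u ≤ 0` the central terms vanish and only nonnegative neighbour values remain; where `u ≥
  -- 0` the inequality for `u` survives raising its neighbours to their positive parts.
  rcases le_total (u (Fin.snoc x.1 t)) 0 with h0 | h0
  · have : positiveSlice hΩ hδ u t x = 0 := max_eq_left h0
    rw [this]
    linarith
  · have : positiveSlice hΩ hδ u t x = u (Fin.snoc x.1 t) := max_eq_right h0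
    rw [this]
    linarith

theorem one_le_cosh_argument (δ : ℝ) (S : Finset (Fin n → ℤ)) (k : ℕ) :
    1 ≤ 1 + δ ^ 2 * dirichletEigenvalue δ S k / 2 := by
  have := dirichletEigenvalue_nonneg δ S k
  have : 0 ≤ δ ^ 2 * dirichletEigenvalue δ S k / 2 := by positivity
  linarith

theorem cosh_mul_cylinderExponent (hδ : 0 < δ) (S : Finset (Fin n → ℤ)) (k : ℕ) :
    Real.cosh (δ * cylinderExponent δ S k) = 1 + δ ^ 2 * dirichletEigenvalue δ S k / 2 := by
  rw [cylinderExponent, mul_inv_cancel_left₀ hδ.ne',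
    Real.cosh_arcosh (one_le_cosh_argument δ S k)]

/-- The `ℓ²` norms of the slices of the positive part satisfy a one-dimensional difference
inequality. -/
theorem IsPositiveCylinderSubsolution.sqrt_sum_recurrence {m : ℕ} {A : ℝ}
    (h : IsPositiveCylinderSubsolution hΩ hδ (m * δ) A u) {t : ℤ} (ht : |t| < m) :
    2 * Real.cosh (δ * cylinderExponent δ (latticeFinset hΩ hδ) 1)
        * √(∑ x, positiveSlice hΩ hδ u t x ^ 2)
      ≤ √(∑ x, positiveSlice hΩ hδ u (t + 1) x ^ 2)
        + √(∑ x, positiveSlice hΩ hδ u (t - 1) x ^ 2) := by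
  set S := latticeFinset hΩ hδ
  set f := positiveSlice hΩ hδ u
  have hsum : ∑ x, f t x * (2 * f t x + δ ^ 2 * dirichletLaplacian δ S (f t) x)
      ≤ ∑ x, f t x * (f (t + 1) x + f (t - 1) x) :=
    Finset.sum_le_sum fun x _ =>
      mul_le_mul_of_nonneg_left (h.positiveSlice_subharmonic ht x) (positiveSlice_nonneg t x)
  have hl : ∑ x, f t x * (2 * f t x + δ ^ 2 * dirichletLaplacian δ S (f t) x)
      = 2 * ∑ x, f t x ^ 2 + δ ^ 2 * ∑ x, f t x * dirichletLaplacian δ S (f t) x := by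
    rw [Finset.mul_sum, Finset.mul_sum, ← Finset.sum_add_distrib]
    exact Finset.sum_congr rfl fun x _ => by ring
  have hr : ∑ x, f t x * (f (t + 1) x + f (t - 1) x)
      = ∑ x, f t x * f (t + 1) x + ∑ x, f t x * f (t - 1) x := by
    simp only [mul_add, Finset.sum_add_distrib]
  have hray := mul_le_mul_of_nonneg_left (dirichletEigenvalue_one_mul_le δ S (f t)) (sq_nonneg δ)
  have hc1 := Real.sum_mul_le_sqrt_mul_sqrt Finset.univ (f t) (f (t + 1))
  have hc2 := Real.sum_mul_le_sqrt_mul_sqrt Finset.univ (f t) (f (t - 1))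
  have hsq := Real.mul_self_sqrt (Finset.sum_nonneg fun x (_ : x ∈ Finset.univ) => sq_nonneg (f t x))
  rw [cosh_mul_cylinderExponent hδ]
  -- The paired inequality carries an extra factor of the slice norm, which can be cancelled unless
  -- it is zero, a trivial case.
  rcases (Real.sqrt_nonneg (∑ x, f t x ^ 2)).eq_or_lt with h0 | h0
  · rw [← h0, mul_zero]
    positivity
  · refine le_of_mul_le_mul_left ?_ h0
    rw [hl, hr] at hsum
    set q := √(∑ x, f t x ^ 2)
    rw [← hsq] at hsum hray
    nlinarith

/-- The maximum of a positive subsolution on a truncated cylinder grows at least like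
`exp (a₁ N)`. -/
theorem IsPositiveCylinderSubsolution.exists_isGreatest {N A : ℝ}
    (h : IsPositiveCylinderSubsolution hΩ hδ N A u) (hN : ∃ m : ℕ, N = m * δ) :
    ∃ M : ℝ, IsGreatest (u '' truncatedCylinder Ω δ N) M ∧ 0 < M ∧
      A / 2 * Real.exp (cylinderExponent δ (latticeFinset hΩ hδ) 1 * N) ≤ M := by
  obtain ⟨m, rfl⟩ := hN
  set S := latticeFinset hΩ hδ
  set a := cylinderExponent δ S 1
  set f := positiveSlice hΩ hδ u
  have hsum0 : ∑ x, f 0 x ^ 2 = A ^ 2 * (S.card : ℝ) := by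
    rw [← h.sum_eq, ← Finset.sum_coe_sort S]
    rfl
  -- Positivity of the sum at height `0` yields a point with `u > 0`. Hence `M > 0`, so `M` also
  -- bounds the positive part of `u`.
  obtain ⟨x₀, -, hx₀⟩ := Finset.exists_ne_zero_of_sum_ne_zero (hsum0 ▸ h.pos.ne')
  have hx₀' : 0 < u (Fin.snoc x₀.1 (0 : ℤ)) := by
    by_contra hle
    exact hx₀ (by simp [f, positiveSlice, max_eq_left (not_lt.1 hle)])
  have hx₀m : (Fin.snoc x₀.1 (0 : ℤ) : Fin (n + 1) → ℤ) ∈ truncatedCylinder Ω δ (m * δ) :=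
    (snoc_mem_truncatedCylinder hδ).2 ⟨mem_latticeFinset.1 x₀.2, by simp⟩
  have hfin := (truncatedCylinder_finite hΩ hδ m).image u
  obtain ⟨M, hM⟩ := hfin.exists_maximal ⟨_, Set.mem_image_of_mem u hx₀m⟩
  have hMg : IsGreatest (u '' truncatedCylinder Ω δ (m * δ)) M :=
    ⟨hM.1, fun y hy => (le_total y M).elim id (hM.2 hy)⟩
  have hMpos : 0 < M := hx₀'.trans_le (hMg.2 (Set.mem_image_of_mem u hx₀m))
  refine ⟨M, hMg, hMpos, ?_⟩
  have hK : 0 < (S.card : ℝ) := by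
    exact_mod_cast Finset.card_pos.2 ⟨x₀.1, x₀.2⟩
  have hbound : ∀ t : ℤ, |t| ≤ m → √(∑ x, f t x ^ 2) ≤ M * √(S.card : ℝ) := fun t ht => by
    rw [← Real.sqrt_sq hMpos.le, ← Real.sqrt_mul (sq_nonneg M)]
    refine Real.sqrt_le_sqrt ((Finset.sum_le_card_nsmul _ _ (M ^ 2) fun x _ => ?_).trans_eq ?_)
    · exact pow_le_pow_left₀ (positiveSlice_nonneg t x) (max_le hMpos.le (hMg.2
        (Set.mem_image_of_mem u ((snoc_mem_truncatedCylinder hδ).2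
          ⟨mem_latticeFinset.1 x.2, ht⟩)))) 2
    · rw [Finset.card_univ, Fintype.card_coe, nsmul_eq_mul, mul_comm]
  have hcmp := two_mul_cosh_mul_le_of_recurrence (g := fun t => √(∑ x, f t x ^ 2))
    (θ := δ * a) (m := m) fun t ht => h.sqrt_sum_recurrence ht
  have hb1 := hbound m (by simp)
  have hb2 := hbound (-m) (by simp)
  simp only [hsum0, Real.sqrt_mul (sq_nonneg A), Real.sqrt_sq_eq_abs] at hcmp
  -- The initial norm is `|A| √K` and both end norms are at most `M √K`; the factor `√K` cancels.
  have hmain : Real.cosh (m * (δ * a)) * |A| ≤ M := by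
    refine le_of_mul_le_mul_right ?_ (Real.sqrt_pos.2 hK)
    linarith
  have hexp : Real.exp (a * (m * δ)) / 2 ≤ Real.cosh (m * (δ * a)) := by
    rw [Real.cosh_eq, show a * (m * δ) = m * (δ * a) by ring]
    linarith [Real.exp_pos (-(m * (δ * a)))]
  calc A / 2 * Real.exp (a * (m * δ)) = Real.exp (a * (m * δ)) / 2 * A := by ring
    _ ≤ Real.exp (a * (m * δ)) / 2 * |A| :=
      mul_le_mul_of_nonneg_left (le_abs_self A) (by positivity)
    _ ≤ _ := (mul_le_mul_of_nonneg_right hexp (abs_nonneg A)).trans hmain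

end Cylinder

/-! ### The two growth estimates. -/

theorem theorem4 (n : ℕ) (hn : 1 ≤ n) (Ω : Set (EuclideanSpace ℝ (Fin n)))
    (hopen : IsOpen Ω) (hconn : IsConnected Ω) (hbdd : Bornology.IsBounded Ω) :
    (∀ (δ : ℝ) (hδ : 0 < δ) (N : ℝ), (∃ m : ℕ, N = m * δ) →
      ∀ (A : ℝ) (u : (Fin (n + 1) → ℤ) → ℝ),
        IsPositiveCylinderSubsolution hbdd hδ N A u →
        ∃ M : ℝ, IsGreatest (u '' truncatedCylinder Ω δ N) M ∧
          A / 2 * (∑ k ∈ Finset.Icc 1 (latticeFinset hbdd hδ).card,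
            Real.exp (-(cylinderExponent δ (latticeFinset hbdd hδ) k * N)))⁻¹ ≤ M) ∧
    (∃ C : ℝ, 0 < C ∧
      ∀ (δ : ℝ) (hδ : 0 < δ) (N : ℕ), (∃ m : ℕ, (N : ℝ) = m * δ) →
        ∀ (A : ℝ) (u : (Fin (n + 1) → ℤ) → ℝ),
          IsPositiveCylinderSubsolution hbdd hδ N A u →
          ∃ M : ℝ, IsGreatest (u '' truncatedCylinder Ω δ N) M ∧
            C * A * Real.exp (cylinderExponent δ (latticeFinset hbdd hδ) 1 * N) ≤ M) := by
  refine ⟨fun δ hδ N hN A u h => ?_, 1 / 2, by norm_num, fun δ hδ N hN A u h => ?_⟩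
  · obtain ⟨M, hM, hMpos, hle⟩ := h.exists_isGreatest hN
    refine ⟨M, hM, ?_⟩
    have hK : 1 ≤ (latticeFinset hbdd hδ).card := by
      refine Nat.one_le_iff_ne_zero.2 fun h0 => h.pos.ne' ?_
      rw [h0, Nat.cast_zero, mul_zero]
    have hsum := Finset.single_le_sum
      (f := fun k => Real.exp (-(cylinderExponent δ (latticeFinset hbdd hδ) k * N)))
      (fun k _ => (Real.exp_pos _).le) (Finset.mem_Icc.2 ⟨le_rfl, hK⟩)
    have hinv := inv_anti₀ (Real.exp_pos _) hsum
    rw [← Real.exp_neg, neg_neg] at hinv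
    -- The sign of `A` is free: for `A ≤ 0` the bound is nonpositive while `M > 0`, and only for `A
    -- ≥ 0` does the inverted sum estimate multiply through.
    rcases le_total A 0 with hA | hA
    · refine le_trans (mul_nonpos_of_nonpos_of_nonneg (by linarith) ?_) hMpos.le
      positivity
    · exact (mul_le_mul_of_nonneg_left hinv (by linarith)).trans hle
  · obtain ⟨M, hM, -, hle⟩ := h.exists_isGreatest hN
    exact ⟨M, hM, by rwa [one_div_mul_eq_div]⟩
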